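/- Let $p(y|x)$ be the transition probabilities of a discrete memoryless channel with finite input alphabet $\mathcal X$ and finite output alphabet $\mathcal Y$, such that every $y\in\mathcal Y$ has $p(y|x)>0$ for some $x\in\mathcal X$. Let $C=\max_{q} I(X;Y)$ be its capacity (maximum over input distributions $q$, natural logarithms), $C_1=\max_{x,x'\in\mathcal X} D\big(p(\cdot|x)\,\|\,p(\cdot|x')\big)$ with $D$ the Kullback--Leibler divergence, and $\lambda=\min_{x,y}p(y|x)$, and assume that $C>0$ and $C_1<\infty$. A variable-length block code with feedback for $M\ge 2$ messages consists of encoding functions $f_n:\{1,\dots,M\}\times\mathcal Y^{n-1}\to\mathcal X$ ($n\ge 1$), a decoding time $T$ that is a stopping time of the output sequence $Y_1,Y_2,\dots$, and a decoded message $\hat W\in\{1,\dots,M\}$ that is a function of $Y_1,\dots,Y_T$. The message $W$ is uniform on $\{1,\dots,M\}$ and, given $W$ and $Y_1,\dots,Y_{n-1}$, the output $Y_n$ has distribution $p(\cdot|X_n)$ with $X_n=f_n(W,Y_1,\dots,Y_{n-1})$. Let $P_e=\Pr(\hat W\ne W)$ (with $T=\infty$ counted as an error), and let $h(\delta)=-\delta\ln\delta-(1-\delta)\ln(1-\delta)$.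 **Theorem (Burnashev's lower bound).** For every such code $P_e>0$, and for every $0<\delta\le\frac12$, $$E[T]\ \ge\ \Big(1-\delta-\frac{P_e}{\delta}\Big)\frac{\ln M}{C}+\frac{-\ln P_e}{C_1}-\frac{h(\delta)}{C}+\frac{\ln(\lambda\delta)-\ln 4}{C_1}$$ (trivially so if $E[T]=\infty$). Moreover, there is a function $\varepsilon>0$ depending only on the channel, with $\varepsilon(t)\to0$ as $t\downarrow0$, such that for every $M\ge2$ and every such code $$E[T]\ \ge\ \Big(\frac{\ln M}{C}-\frac{\ln P_e}{C_1}\Big)\big(1-\varepsilon(P_e)\big).$$ -/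

import Mathlib

open MeasureTheory InformationTheory Filter Topology
open scoped ENNReal

/-! A discrete memoryless channel with finite input alphabet `X` and finite output alphabet `Y` is
a family `p : X → PMF Y`; `p x y` is the transition probability `p(y|x)`. -/

/-- The mutual information `I(X;Y)` (in nats) between input and output of the channel `p` when the
input has distribution `q`: the Kullback-Leibler divergence of the joint law from the product of
the marginals. -/
noncomputable def mutualInfo {X Y : Type*} [MeasurableSpace X] [MeasurableSpace Y]
    (p : X → PMF Y) (q : PMF X) : ℝ≥0∞ :=
  klDiv (q.bind fun x => (p x).map fun y => (x, y)).toMeasure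
    (q.toMeasure.prod (q.bind p).toMeasure)

/-- The capacity `C` of the channel: the maximal mutual information over all input distributions. -/
noncomputable def channelCapacity {X Y : Type*} [MeasurableSpace X] [MeasurableSpace Y]
    (p : X → PMF Y) : ℝ≥0∞ :=
  ⨆ q : PMF X, mutualInfo p q

/-- `C₁ = max_{x,x'} D(p(·|x) ‖ p(·|x'))`. -/
noncomputable def maxInputDivergence {X Y : Type*} [MeasurableSpace Y] (p : X → PMF Y) : ℝ≥0∞ :=
  ⨆ (x : X) (x' : X), klDiv (p x).toMeasure (p x').toMeasure

/-- `λ = min_{x,y} p(y|x)`. -/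
noncomputable def minTransitionProb {X Y : Type*} (p : X → PMF Y) : ℝ :=
  ⨅ xy : X × Y, (p xy.1 xy.2).toReal

/-- The receiver's filtration on output sequences. The sequence `Y₁, Y₂, …` of channel outputs is
indexed from `0`, so the first `n` outputs are the coordinates `< n`, and time `0` carries no
information. -/
def outputFiltration (Y : Type*) [MeasurableSpace Y] :
    Filtration ℕ (MeasurableSpace.pi : MeasurableSpace (ℕ → Y)) where
  seq n := cylinderEvents (Set.Iio n)
  mono' _ _ h := cylinderEvents_mono (Set.Iio_subset_Iio h)
  le' _ := cylinderEvents_le_pi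

/-- A (deterministic) variable-length block code with feedback for `M` messages. -/
structure FeedbackCode (X Y : Type*) [MeasurableSpace Y] (M : ℕ) where
  /-- `encode n w y` is the channel input number `n + 1`, a function of the message `w` and of the
  `n` past outputs `y`. -/
  encode : (n : ℕ) → Fin M → (Fin n → Y) → X
  /-- The decoding time as a function of the output sequence. -/
  decodingTime : (ℕ → Y) → ℕ∞
  /-- Whether to stop at time `n` is decided by the first `n` outputs. -/
  isStoppingTime : IsStoppingTime (outputFiltration Y) decodingTime
  /-- The decoded message. -/
  decode : (ℕ → Y) → Fin M
  /-- The decoded message is determined by the outputs observed until the decoding time. -/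
  measurable_decode : Measurable[isStoppingTime.measurableSpace] decode

/-- `W` is the transmitted message and `Z 0, Z 1, …` are the channel outputs when a uniformly
distributed message is sent over the channel `p` by means of the code `c`:
`P(W = w) = 1 / M`, and given `W = w` and the first `n` outputs `y`, the next output is `b` with
probability `p (c.encode n w y) b`. -/
structure IsTransmission {X Y Ω : Type*} [MeasurableSpace Y] [MeasurableSpace Ω] {M : ℕ}
    (p : X → PMF Y) (c : FeedbackCode X Y M) (μ : Measure Ω) (W : Ω → Fin M) (Z : ℕ → Ω → Y) :
    Prop where
  measurable_message : Measurable W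
  measurable_output : ∀ n, Measurable (Z n)
  message_uniform : ∀ w, μ {ω | W ω = w} = (M : ℝ≥0∞)⁻¹
  output_law : ∀ (n : ℕ) (w : Fin M) (y : Fin n → Y) (b : Y),
    μ {ω | W ω = w ∧ (∀ i : Fin n, Z i ω = y i) ∧ Z n ω = b} =
      μ {ω | W ω = w ∧ ∀ i : Fin n, Z i ω = y i} * p (c.encode n w y) b

/-- The expected decoding time `E[T]`. -/
noncomputable def expectedTime {X Y Ω : Type*} [MeasurableSpace Y] [MeasurableSpace Ω] {M : ℕ}
    (c : FeedbackCode X Y M) (μ : Measure Ω) (Z : ℕ → Ω → Y) : ℝ≥0∞ :=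
  ∫⁻ ω, (c.decodingTime fun n => Z n ω : ℝ≥0∞) ∂μ

/-- The error probability `P_e`; never decoding counts as an error. -/
noncomputable def errorProb {X Y Ω : Type*} [MeasurableSpace Y] [MeasurableSpace Ω] {M : ℕ}
    (c : FeedbackCode X Y M) (μ : Measure Ω) (W : Ω → Fin M) (Z : ℕ → Ω → Y) : ℝ :=
  μ.real {ω | c.decodingTime (fun n => Z n ω) = ⊤ ∨ c.decode (fun n => Z n ω) ≠ W ω}

/-! The proof runs two potential functions along the tree of received outputs. Messages carry
unnormalised weights `a i`, the probability of message `i` jointly with the outputs so far. An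
output `b` multiplies them by the transition probabilities, so masses, costs and errors simply add
over the branches and no conditioning is needed.

Communication: while no posterior exceeds `1 - δ`, the negative entropy, initially `-log M`, rises
per use by at most `C` on average, since the rise is a mutual information
(`ChannelBounds.sum_negEntropy_le`). Confirmation: once some message `w` exceeds `1 - δ`, the
problem is a binary test of `w` against the rest, whose expected log-likelihood ratio rises by at
most `C₁` per use, by convexity of the divergence (`ChannelBounds.sum_logLikelihood_le`). At the
switch, Fano bounds the entropy reached, and the ratio starts at most at `-log (lam * δ)`, because
one output cannot move a posterior further. At the end the ratio must be about `-log P_e`, up to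
`log 4`.

Each phase is an induction over the tree (`confirmation_phase_le`, `communication_phase_le`).
Stopping before the switch has error probability at least `δ`, hence total probability at most `P_e
/ δ`; this explains the loss `P_e / δ` in the coefficient of `log M`, while `δ` comes from Fano. A
general code is truncated at depth `N`, which raises the error by at most `P(T > N)`, and `N → ∞`.
The asymptotic form takes `δ = 1 / log (1 / P_e)`. -/

/-! ### Inequalities for finite sums of logarithms -/

/-- `Σ_i a_i log (a_i / S)` with `S = Σ_i a_i`: minus the total mass times the entropy of the
normalised weights. -/
noncomputable def negEntropy {ι : Type*} [Fintype ι] (a : ι → ℝ) : ℝ :=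
  ∑ i, a i * Real.log (a i / ∑ j, a j)

/-- `(2 a_i - S) log (a_i / (S - a_i))` with `S = Σ_j a_j`: the expected log-likelihood ratio
between "`i`" and "not `i`", scaled by the total mass. -/
noncomputable def logLikelihood {ι : Type*} [Fintype ι] (a : ι → ℝ) (i : ι) : ℝ :=
  (2 * a i - ∑ j, a j) * Real.log (a i / (∑ j, a j - a i))

/-- Gibbs' inequality: `log x ≤ x - 1` at `x = r i * S / a i`, weighted by `a i` and summed.
Subprobability vectors `r` suffice. -/
theorem sum_mul_log_le_negEntropy {ι : Type*} [Fintype ι] {a r : ι → ℝ} (ha : ∀ i, 0 < a i)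
    (hr : ∀ i, 0 < r i) (hr1 : ∑ i, r i ≤ 1) :
    ∑ i, a i * Real.log (r i) ≤ negEntropy a := by
  rcases isEmpty_or_nonempty ι with h | h
  · simp [negEntropy]
  set S := ∑ j, a j with hS
  have hSpos : 0 < S := Finset.sum_pos (fun i _ => ha i) Finset.univ_nonempty
  have key : ∀ i, a i * Real.log (r i) - a i * Real.log (a i / S) ≤ r i * S - a i := by
    intro i
    have hai := ha i
    have h1 : Real.log (r i * S / a i) ≤ r i * S / a i - 1 :=
      Real.log_le_sub_one_of_pos (div_pos (mul_pos (hr i) hSpos) hai)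
    have h2 : Real.log (r i * S / a i) = Real.log (r i) - Real.log (a i / S) := by
      rw [Real.log_div (mul_pos (hr i) hSpos).ne' hai.ne', Real.log_mul (hr i).ne' hSpos.ne',
        Real.log_div hai.ne' hSpos.ne']
      ring
    have h3 := mul_le_mul_of_nonneg_left h1 hai.le
    rw [h2] at h3
    have h4 : a i * (r i * S / a i - 1) = r i * S - a i := by field_simp
    linarith
  have h := Finset.sum_le_sum fun i (_ : i ∈ Finset.univ) => key i
  rw [Finset.sum_sub_distrib, Finset.sum_sub_distrib, ← Finset.sum_mul, ← hS] at h
  have : (∑ i, r i) * S ≤ 1 * S := mul_le_mul_of_nonneg_right hr1 hSpos.le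
  unfold negEntropy
  linarith

theorem neg_mul_log_card_le_negEntropy {ι : Type*} [Fintype ι] [Nonempty ι] {a : ι → ℝ}
    (ha : ∀ i, 0 < a i) :
    -((∑ i, a i) * Real.log (Fintype.card ι)) ≤ negEntropy a := by
  have hc : (0 : ℝ) < Fintype.card ι := by exact_mod_cast Fintype.card_pos
  have h := sum_mul_log_le_negEntropy (r := fun _ => (Fintype.card ι : ℝ)⁻¹) ha
    (fun _ => inv_pos.2 hc) (by simp [hc.ne'])
  rw [← Finset.sum_mul, Real.log_inv] at h
  linarith

/-- Fano's inequality for a dominant weight. -/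
theorem fano_le_negEntropy {ι : Type*} [Fintype ι] {a : ι → ℝ} (ha : ∀ i, 0 < a i)
    (i : ι) {δ : ℝ} (hδ : δ ≤ 1 / 2) (hi : (1 - δ) * ∑ j, a j ≤ a i) (hi' : a i < ∑ j, a j) :
    -((∑ j, a j) * (Real.binEntropy δ + δ * Real.log (Fintype.card ι))) ≤ negEntropy a := by
  classical
  have : Nonempty ι := ⟨i⟩
  set S := ∑ j, a j with hS
  have hai := ha i
  have hSpos : 0 < S := hai.trans hi'
  have hc : (0 : ℝ) < Fintype.card ι := by exact_mod_cast Fintype.card_pos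
  have hc1 : (1 : ℝ) ≤ Fintype.card ι := by exact_mod_cast Fintype.card_pos
  set t := 1 - a i / S with ht
  have hat : a i = (1 - t) * S := by rw [ht]; field_simp; ring
  have ht0 : 0 < t := by rw [ht, sub_pos, div_lt_one hSpos]; exact hi'
  have ht1 : t < 1 := by rw [ht]; have := div_pos hai hSpos; linarith
  have htδ : t ≤ δ := by
    rw [hat] at hi
    have := le_of_mul_le_mul_right hi hSpos
    linarith
  -- The comparison vector gives `i` its true share and spreads `t` over the full cardinality rather
  -- than over the others only; its total is below `1`, which Gibbs' inequality tolerates.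
  have h := sum_mul_log_le_negEntropy (a := a)
    (r := fun j => if j = i then 1 - t else t / Fintype.card ι) ha
    (fun j => by split_ifs; · linarith
                 · exact div_pos ht0 hc)
    (by
      have h1 : ∀ j, (if j = i then 1 - t else t / Fintype.card ι)
          ≤ (if j = i then 1 - t else 0) + t / Fintype.card ι := by
        intro j; split_ifs
        · have := div_pos ht0 hc; linarith
        · linarith
      refine (Finset.sum_le_sum fun j _ => h1 j).trans ?_
      rw [Finset.sum_add_distrib]
      simp only [Finset.sum_ite_eq', Finset.mem_univ, if_true, Finset.sum_const, Finset.card_univ,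
        nsmul_eq_mul]
      field_simp
      linarith)
  refine le_trans ?_ h
  have h2 : ∑ j, a j * Real.log (if j = i then 1 - t else t / Fintype.card ι)
      = a i * Real.log (1 - t) + (S - a i) * Real.log (t / Fintype.card ι) := by
    rw [hS, ← Finset.add_sum_erase _ a (Finset.mem_univ i),
      ← Finset.add_sum_erase _ _ (Finset.mem_univ i), add_sub_cancel_left, Finset.sum_mul]
    simp only [if_true]
    congr 1
    refine Finset.sum_congr rfl fun j hj => ?_
    rw [if_neg (Finset.ne_of_mem_erase hj)]
  rw [h2, Real.log_div ht0.ne' hc.ne', hat]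
  have h3 : Real.binEntropy t ≤ Real.binEntropy δ :=
    Real.binEntropy_strictMonoOn.monotoneOn ⟨ht0.le, by linarith⟩ ⟨by linarith, by linarith⟩ htδ
  have h4 : t * Real.log (Fintype.card ι) ≤ δ * Real.log (Fintype.card ι) :=
    mul_le_mul_of_nonneg_right htδ (Real.log_nonneg hc1)
  have h5 : Real.binEntropy t = -(t * Real.log t) - (1 - t) * Real.log (1 - t) := by
    rw [Real.binEntropy_eq_negMulLog_add_negMulLog_one_sub, Real.negMulLog, Real.negMulLog]; ring
  nlinarith [mul_le_mul_of_nonneg_left (add_le_add h3 h4) hSpos.le]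

/-- Convexity of the divergence in its second argument: Jensen for the concave logarithm, output by
output. -/
theorem sum_mul_log_div_mix_le {ι Y : Type*} [Fintype Y] (s : Finset ι) {c : ι → ℝ}
    {κ : ι → Y → ℝ} {r : Y → ℝ} {B : ℝ} (hc : ∀ j ∈ s, 0 ≤ c j) (hc1 : ∑ j ∈ s, c j = 1)
    (hκ : ∀ j b, 0 < κ j b) (hr : ∀ b, 0 < r b)
    (h : ∀ j ∈ s, ∑ b, r b * Real.log (r b / κ j b) ≤ B) :
    ∑ b, r b * Real.log (r b / ∑ j ∈ s, c j * κ j b) ≤ B := by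
  have hpos : ∀ b, 0 < ∑ j ∈ s, c j * κ j b := fun b =>
    (convex_Ioi (0 : ℝ)).sum_mem hc hc1 fun j _ => hκ j b
  calc ∑ b, r b * Real.log (r b / ∑ j ∈ s, c j * κ j b)
      ≤ ∑ b, ∑ j ∈ s, c j * (r b * Real.log (r b / κ j b)) := by
        refine Finset.sum_le_sum fun b _ => ?_
        have hJ := strictConcaveOn_log_Ioi.concaveOn.le_map_sum hc hc1
          (p := fun j => κ j b) fun j _ => hκ j b
        simp only [smul_eq_mul] at hJ
        have e : ∑ j ∈ s, c j * (r b * Real.log (r b / κ j b))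
            = r b * (Real.log (r b) - ∑ j ∈ s, c j * Real.log (κ j b)) := by
          have e0 : r b * Real.log (r b) = ∑ j ∈ s, c j * (r b * Real.log (r b)) := by
            rw [← Finset.sum_mul, hc1, one_mul]
          rw [mul_sub, Finset.mul_sum, e0, ← Finset.sum_sub_distrib]
          refine Finset.sum_congr rfl fun j _ => ?_
          rw [Real.log_div (hr b).ne' (hκ j b).ne']; ring
        rw [e, Real.log_div (hr b).ne' (hpos b).ne']
        exact mul_le_mul_of_nonneg_left (by linarith) (hr b).le
    _ = ∑ j ∈ s, c j * ∑ b, r b * Real.log (r b / κ j b) := by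
        rw [Finset.sum_comm]; simp_rw [Finset.mul_sum]
    _ ≤ ∑ j ∈ s, c j * B :=
        Finset.sum_le_sum fun j hj => mul_le_mul_of_nonneg_left (h j hj) (hc j hj)
    _ = B := by rw [← Finset.sum_mul, hc1, one_mul]

/-- Convexity of the divergence in its first argument: Jensen for `x * log x`, output by output. -/
theorem sum_mix_mul_log_div_le {ι Y : Type*} [Fintype Y] (s : Finset ι) {c : ι → ℝ}
    {κ : ι → Y → ℝ} {r : Y → ℝ} {B : ℝ} (hc : ∀ j ∈ s, 0 ≤ c j) (hc1 : ∑ j ∈ s, c j = 1)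
    (hκ : ∀ j b, 0 < κ j b) (hr : ∀ b, 0 < r b)
    (h : ∀ j ∈ s, ∑ b, κ j b * Real.log (κ j b / r b) ≤ B) :
    ∑ b, (∑ j ∈ s, c j * κ j b) * Real.log ((∑ j ∈ s, c j * κ j b) / r b) ≤ B := by
  have hpos : ∀ b, 0 < ∑ j ∈ s, c j * κ j b := fun b =>
    (convex_Ioi (0 : ℝ)).sum_mem hc hc1 fun j _ => hκ j b
  calc ∑ b, (∑ j ∈ s, c j * κ j b) * Real.log ((∑ j ∈ s, c j * κ j b) / r b)
      ≤ ∑ b, ∑ j ∈ s, c j * (κ j b * Real.log (κ j b / r b)) := by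
        refine Finset.sum_le_sum fun b _ => ?_
        have hJ := Real.convexOn_mul_log.map_sum_le hc hc1
          (p := fun j => κ j b) fun j _ => (hκ j b).le
        simp only [smul_eq_mul] at hJ
        have e : ∑ j ∈ s, c j * (κ j b * Real.log (κ j b / r b))
            = ∑ j ∈ s, c j * (κ j b * Real.log (κ j b))
              - (∑ j ∈ s, c j * κ j b) * Real.log (r b) := by
          rw [Finset.sum_mul, ← Finset.sum_sub_distrib]
          refine Finset.sum_congr rfl fun j _ => ?_
          rw [Real.log_div (hκ j b).ne' (hr b).ne']; ring
        rw [e, Real.log_div (hpos b).ne' (hr b).ne']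
        linarith
    _ = ∑ j ∈ s, c j * ∑ b, κ j b * Real.log (κ j b / r b) := by
        rw [Finset.sum_comm]; simp_rw [Finset.mul_sum]
    _ ≤ ∑ j ∈ s, c j * B :=
        Finset.sum_le_sum fun j hj => mul_le_mul_of_nonneg_left (h j hj) (hc j hj)
    _ = B := by rw [← Finset.sum_mul, hc1, one_mul]

/-! ### One channel use -/

/-- `k x y` are the transition probabilities of a channel, all at least `lam`, whose mutual
information is at most `C` and whose divergences between inputs are at most `C₁`. -/
structure ChannelBounds {X Y : Type*} [Fintype X] [Fintype Y] (k : X → Y → ℝ) (C C₁ lam : ℝ) :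
    Prop where
  capacity_pos : 0 < C
  divergence_pos : 0 < C₁
  lam_pos : 0 < lam
  lam_le : ∀ x y, lam ≤ k x y
  sum_eq_one : ∀ x, ∑ y, k x y = 1
  rate_le : ∀ q : X → ℝ, (∀ x, 0 ≤ q x) → ∑ x, q x = 1 →
    ∑ x, q x * ∑ y, k x y * Real.log (k x y / ∑ x', q x' * k x' y) ≤ C
  divergence_le : ∀ x x', ∑ y, k x y * Real.log (k x y / k x' y) ≤ C₁

namespace ChannelBounds

variable {ι X Y : Type*} [Fintype ι] [Fintype X] [Fintype Y] {k : X → Y → ℝ} {C C₁ lam : ℝ}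

theorem pos (hk : ChannelBounds k C C₁ lam) (x : X) (y : Y) : 0 < k x y :=
  hk.lam_pos.trans_le (hk.lam_le x y)

theorem le_one (hk : ChannelBounds k C C₁ lam) (x : X) (y : Y) : k x y ≤ 1 := by
  rw [← hk.sum_eq_one x]
  exact Finset.single_le_sum (fun y _ => (hk.pos x y).le) (Finset.mem_univ y)

theorem lam_le_one [Nonempty X] (hk : ChannelBounds k C C₁ lam) : lam ≤ 1 := by
  obtain ⟨x⟩ := ‹Nonempty X›
  obtain ⟨y⟩ : Nonempty Y := by
    by_contra h
    have := not_nonempty_iff.1 h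
    simpa using hk.sum_eq_one x
  exact (hk.lam_le x y).trans (hk.le_one x y)

theorem sum_sum_mul {ι : Type*} (hk : ChannelBounds k C C₁ lam)
    (s : Finset ι) (a : ι → ℝ) (e : ι → X) :
    ∑ b, ∑ i ∈ s, a i * k (e i) b = ∑ i ∈ s, a i := by
  rw [Finset.sum_comm]
  refine Finset.sum_congr rfl fun i _ => ?_
  rw [← Finset.mul_sum, hk.sum_eq_one, mul_one]

/-- The increase is exactly `S` times the mutual information of one channel use whose input law `q`
is the image under `e` of the posterior `a / S`. -/
theorem sum_negEntropy_le (hk : ChannelBounds k C C₁ lam) [Nonempty ι] {a : ι → ℝ}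
    (ha : ∀ i, 0 < a i) (e : ι → X) :
    ∑ b, negEntropy (fun i => a i * k (e i) b) ≤ negEntropy a + (∑ i, a i) * C := by
  classical
  set S := ∑ i, a i with hS
  have hSpos : 0 < S := Finset.sum_pos (fun i _ => ha i) Finset.univ_nonempty
  set q : X → ℝ := fun x => ∑ i with e i = x, a i / S with hq
  have hqsum : ∀ g : X → ℝ, ∑ x, q x * g x = ∑ i, a i / S * g (e i) := by
    intro g
    rw [← Finset.sum_fiberwise (s := Finset.univ) (g := e)]
    refine Finset.sum_congr rfl fun x _ => ?_
    rw [hq, Finset.sum_mul]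
    refine Finset.sum_congr rfl fun i hi => ?_
    rw [(Finset.mem_filter.1 hi).2]
  have hq0 : ∀ x, 0 ≤ q x := fun x => Finset.sum_nonneg fun i _ => (div_pos (ha i) hSpos).le
  have hq1 : ∑ x, q x = 1 := by
    have := hqsum fun _ => 1
    simp only [mul_one] at this
    rw [this, ← Finset.sum_div, ← hS, div_self hSpos.ne']
  have hm : ∀ b, ∑ x, q x * k x b = (∑ i, a i * k (e i) b) / S := by
    intro b
    rw [hqsum fun x => k x b, Finset.sum_div]
    exact Finset.sum_congr rfl fun i _ => by ring
  have hmpos : ∀ b, 0 < ∑ i, a i * k (e i) b := fun b =>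
    Finset.sum_pos (fun i _ => mul_pos (ha i) (hk.pos _ _)) Finset.univ_nonempty
  have hrate := hk.rate_le q hq0 hq1
  simp_rw [hm] at hrate
  rw [hqsum fun x => ∑ y, k x y * Real.log (k x y / ((∑ i, a i * k (e i) y) / S))] at hrate
  have hrate' := mul_le_mul_of_nonneg_left hrate hSpos.le
  have key : ∑ b, negEntropy (fun i => a i * k (e i) b) = negEntropy a +
      S * ∑ i, a i / S * ∑ y, k (e i) y * Real.log (k (e i) y / ((∑ i, a i * k (e i) y) / S)) := by
    unfold negEntropy
    rw [Finset.sum_comm, Finset.mul_sum, ← Finset.sum_add_distrib, ← hS]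
    refine Finset.sum_congr rfl fun i _ => ?_
    have e1 : ∀ b, a i * k (e i) b * Real.log (a i * k (e i) b / ∑ j, a j * k (e j) b)
        = a i * Real.log (a i / S) * k (e i) b +
          a i * (k (e i) b * Real.log (k (e i) b / ((∑ i, a i * k (e i) b) / S))) := by
      intro b
      rw [Real.log_div (mul_pos (ha i) (hk.pos _ _)).ne' (hmpos b).ne',
        Real.log_mul (ha i).ne' (hk.pos _ _).ne', Real.log_div (ha i).ne' hSpos.ne',
        Real.log_div (hk.pos _ _).ne' (div_pos (hmpos b) hSpos).ne',
        Real.log_div (hmpos b).ne' hSpos.ne']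
      ring
    simp_rw [e1]
    rw [Finset.sum_add_distrib, ← Finset.mul_sum, hk.sum_eq_one, ← Finset.mul_sum]
    field_simp
  rw [key]
  linarith

/-- Let `K` be the output law given "not `w`", a mixture of channel rows, and `D` the weight of "not
`w`". The increase is exactly `a w` times the divergence of `k (e w)` from `K` plus `D` times the
reverse divergence. Convexity bounds both by `C₁`. -/
theorem sum_logLikelihood_le (hk : ChannelBounds k C C₁ lam) [Nontrivial ι] {a : ι → ℝ}
    (ha : ∀ i, 0 < a i) (e : ι → X) (w : ι) :
    ∑ b, logLikelihood (fun i => a i * k (e i) b) w ≤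
      logLikelihood a w + (∑ i, a i) * C₁ := by
  classical
  set s := Finset.univ.erase w with hs
  have hsne : s.Nonempty := by
    obtain ⟨j, hj⟩ := exists_ne w
    exact ⟨j, Finset.mem_erase.2 ⟨hj, Finset.mem_univ j⟩⟩
  set D := ∑ i ∈ s, a i with hD
  have hDpos : 0 < D := Finset.sum_pos (fun i _ => ha i) hsne
  have hsplit : ∀ f : ι → ℝ, ∑ i, f i = f w + ∑ i ∈ s, f i := fun f =>
    (Finset.add_sum_erase _ f (Finset.mem_univ w)).symm
  have hA := ha w
  set K : Y → ℝ := fun b => ∑ j ∈ s, a j / D * k (e j) b with hK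
  have hKD : ∀ b, ∑ j ∈ s, a j * k (e j) b = D * K b := by
    intro b
    rw [hK, Finset.mul_sum]
    exact Finset.sum_congr rfl fun j _ => by field_simp
  have hKpos : ∀ b, 0 < K b := fun b =>
    Finset.sum_pos (fun i _ => mul_pos (div_pos (ha i) hDpos) (hk.pos _ _)) hsne
  have hc : ∀ j ∈ s, 0 ≤ a j / D := fun j _ => (div_pos (ha j) hDpos).le
  have hc1 : ∑ j ∈ s, a j / D = 1 := by rw [← Finset.sum_div, ← hD, div_self hDpos.ne']
  have h1 := sum_mul_log_div_mix_le s (κ := fun j => k (e j)) (r := k (e w)) hc hc1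
    (fun j b => hk.pos _ _) (fun b => hk.pos _ _) fun j _ => hk.divergence_le _ _
  have h2 := sum_mix_mul_log_div_le s (κ := fun j => k (e j)) (r := k (e w)) hc hc1
    (fun j b => hk.pos _ _) (fun b => hk.pos _ _) fun j _ => hk.divergence_le _ _
  change ∑ b, k (e w) b * Real.log (k (e w) b / K b) ≤ C₁ at h1
  change ∑ b, K b * Real.log (K b / k (e w) b) ≤ C₁ at h2
  have hKsum : ∑ b, K b = 1 := by
    rw [hK, hk.sum_sum_mul s (fun j => a j / D) e, hc1]
  have key : ∑ b, logLikelihood (fun i => a i * k (e i) b) w = logLikelihood a w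
      + a w * ∑ b, k (e w) b * Real.log (k (e w) b / K b)
      + D * ∑ b, K b * Real.log (K b / k (e w) b) := by
    unfold logLikelihood
    have e1 : ∀ b, (2 * (a w * k (e w) b) - ∑ j, a j * k (e j) b) *
        Real.log (a w * k (e w) b / (∑ j, a j * k (e j) b - a w * k (e w) b)) =
        a w * Real.log (a w / D) * k (e w) b - D * Real.log (a w / D) * K b
        + a w * (k (e w) b * Real.log (k (e w) b / K b))
        + D * (K b * Real.log (K b / k (e w) b)) := by
      intro b
      have hkb := hk.pos (e w) b
      have hKb := hKpos b
      rw [hsplit fun j => a j * k (e j) b, hKD, add_sub_cancel_left,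
        Real.log_div (mul_pos hA hkb).ne' (mul_pos hDpos hKb).ne', Real.log_mul hA.ne' hkb.ne',
        Real.log_mul hDpos.ne' hKb.ne', Real.log_div hA.ne' hDpos.ne',
        Real.log_div hkb.ne' hKb.ne', Real.log_div hKb.ne' hkb.ne']
      ring
    simp_rw [e1]
    rw [Finset.sum_add_distrib, Finset.sum_add_distrib, Finset.sum_sub_distrib, ← Finset.mul_sum,
      ← Finset.mul_sum, ← Finset.mul_sum, ← Finset.mul_sum, hk.sum_eq_one, hKsum, hsplit a,
      add_sub_cancel_left]
    ring
  rw [key, hsplit a]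
  nlinarith [mul_le_mul_of_nonneg_left h1 hA.le, mul_le_mul_of_nonneg_left h2 hDpos.le]

end ChannelBounds

/-! ### Bounds for the binary log-likelihood -/

/-- The right side equals `-log x - log (1 - x) - 2 h(x)`; here `-log x ≥ 0` and `2 h(x) ≤ 2 log 2 =
log 4`. -/
theorem neg_log_one_sub_sub_log_four_le {x : ℝ} (h0 : 0 < x) (h1 : x < 1) :
    -Real.log (1 - x) - Real.log 4 ≤ (2 * x - 1) * Real.log (x / (1 - x)) := by
  rw [Real.log_div h0.ne' (by linarith)]
  have hb := Real.binEntropy_le_log_two (p := x)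
  rw [Real.binEntropy_eq_negMulLog_add_negMulLog_one_sub, Real.negMulLog, Real.negMulLog] at hb
  have h4 : Real.log 4 = 2 * Real.log 2 := by
    rw [show (4 : ℝ) = 2 ^ 2 by norm_num, Real.log_pow]; norm_num
  have hx := Real.log_nonpos h0.le h1.le
  nlinarith

/-- Here `x` is the posterior of `w` and `v` the conditional error probability: at least `1 - x` if
the decision is `w`, at least `x` otherwise. The right side is symmetric under `x ↦ 1 - x`. -/
theorem neg_log_sub_log_four_le {x v : ℝ} (h0 : 0 < x) (h1 : x < 1)
    (hv : 1 - x ≤ v ∨ x ≤ v) :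
    -Real.log v - Real.log 4 ≤ (2 * x - 1) * Real.log (x / (1 - x)) := by
  rcases hv with hv | hv
  · have := neg_log_one_sub_sub_log_four_le h0 h1
    have := Real.log_le_log (by linarith) hv
    linarith
  · have h := neg_log_one_sub_sub_log_four_le (x := 1 - x) (by linarith) (by linarith)
    have := Real.log_le_log h0 hv
    rw [show 1 - (1 - x) = x by ring, Real.log_div (by linarith) h0.ne'] at h
    rw [Real.log_div h0.ne' (by linarith)]
    nlinarith

theorem logLikelihood_eq {ι : Type*} [Fintype ι] (a : ι → ℝ) (w : ι) (hS : ∑ i, a i ≠ 0) :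
    logLikelihood a w = (∑ i, a i) * ((2 * (a w / ∑ i, a i) - 1) *
      Real.log ((a w / ∑ i, a i) / (1 - a w / ∑ i, a i))) := by
  unfold logLikelihood
  have e : (a w / ∑ i, a i) / (1 - a w / ∑ i, a i) = a w / (∑ i, a i - a w) := by
    rw [one_sub_div hS, div_div_div_cancel_right₀ hS]
  rw [e]
  field_simp

section weights

variable {ι : Type*} [Fintype ι] {a : ι → ℝ}

theorem lt_sum_of_nontrivial [Nontrivial ι] (ha : ∀ i, 0 < a i) (w : ι) : a w < ∑ i, a i := by
  obtain ⟨j, hj⟩ := exists_ne w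
  exact Finset.single_lt_sum hj (Finset.mem_univ w) (Finset.mem_univ j) (ha j)
    fun i _ _ => (ha i).le

theorem sum_pos_of_pos [Nonempty ι] (ha : ∀ i, 0 < a i) : 0 < ∑ i, a i :=
  Finset.sum_pos (fun i _ => ha i) Finset.univ_nonempty

/-- The convex function `-log` lies above its tangent at `P`. The resulting bound is linear in `(S,
u)`, so it adds up over leaves and replaces Jensen's inequality. -/
theorem tangent_le_neg_log {u S P : ℝ} (hu : 0 < u) (hS : 0 < S) (hP : 0 < P) :
    S * (-Real.log P + 1) - u / P ≤ S * -Real.log (u / S) := by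
  have h := Real.log_le_sub_one_of_pos (div_pos (div_pos hu hS) hP)
  rw [Real.log_div (div_pos hu hS).ne' hP.ne'] at h
  have h' := mul_le_mul_of_nonneg_left h hS.le
  have e : S * (u / S / P - 1) = u / P - S := by field_simp
  rw [e] at h'
  linarith

/-- Deciding for `d` gives error weight `S - a_d`; the tangent of `log` at `P` bounds the
logarithm of the conditional error probability. -/
theorem tangent_le_logLikelihood [Nontrivial ι] (ha : ∀ i, 0 < a i) (w d : ι) {P : ℝ}
    (hP : 0 < P) :
    (∑ i, a i) * (-Real.log P + 1 - Real.log 4) - (∑ i, a i - a d) / P ≤ logLikelihood a w := by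
  classical
  have hS := sum_pos_of_pos ha
  have hw := lt_sum_of_nontrivial ha w
  have hd := lt_sum_of_nontrivial ha d
  have h1 := tangent_le_neg_log (sub_pos.2 hd) hS hP
  have hx1 : a w / ∑ i, a i < 1 := (div_lt_one hS).2 hw
  have h2 := neg_log_sub_log_four_le (x := a w / ∑ i, a i) (v := (∑ i, a i - a d) / ∑ i, a i)
    (div_pos (ha w) hS) hx1 (by
      by_cases hwd : w = d
      · left; subst hwd; rw [one_sub_div hS.ne']
      · right
        refine div_le_div_of_nonneg_right ?_ hS.le
        have := Finset.add_le_sum (f := a) (s := Finset.univ) (fun i _ => (ha i).le)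
          (Finset.mem_univ w) (Finset.mem_univ d) hwd
        linarith)
  rw [logLikelihood_eq a w hS.ne']
  have h3 := mul_le_mul_of_nonneg_left h2 hS.le
  linarith

/-- For posterior `x ≥ 1/2` the factor `2 * x - 1` lies in `[0, 1]`, and `log (x / (1 - x)) ≤ -log
(1 - x) ≤ -log t`. -/
theorem logLikelihood_le [Nontrivial ι] (ha : ∀ i, 0 < a i) (w : ι) {t : ℝ} (ht : 0 < t)
    (h1 : t * ∑ i, a i ≤ ∑ i, a i - a w) (h2 : 1 / 2 * ∑ i, a i ≤ a w) :
    logLikelihood a w ≤ (∑ i, a i) * -Real.log t := by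
  have hS := sum_pos_of_pos ha
  have hw := lt_sum_of_nontrivial ha w
  rw [logLikelihood_eq a w hS.ne']
  refine mul_le_mul_of_nonneg_left ?_ hS.le
  have hx1 : a w / ∑ i, a i < 1 := (div_lt_one hS).2 hw
  have hx0 : 1 / 2 ≤ a w / ∑ i, a i := (le_div_iff₀ hS).2 h2
  have hxt : t ≤ 1 - a w / ∑ i, a i := by
    rw [one_sub_div hS.ne', le_div_iff₀ hS]; exact h1
  set x := a w / ∑ i, a i
  rw [Real.log_div (by linarith) (by linarith)]
  have l1 := Real.log_nonpos (x := x) (by linarith) hx1.le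
  have l2 := Real.log_nonpos (x := 1 - x) (by linarith) (by linarith)
  have l3 := Real.log_le_log ht hxt
  nlinarith

end weights

/-! ### Decision trees -/

/-- A feedback strategy of bounded length: stop and decide for a message, or transmit the symbols
`e w` and continue according to the channel output. -/
inductive DecisionTree (ι X Y : Type*)
  | leaf (d : ι) : DecisionTree ι X Y
  | node (e : ι → X) (next : Y → DecisionTree ι X Y) : DecisionTree ι X Y

namespace DecisionTree

variable {ι X Y : Type*} [Fintype ι] [Fintype Y]

/-- The expected number of channel uses, with prior weights `a` on the messages. -/
noncomputable def cost (k : X → Y → ℝ) : DecisionTree ι X Y → (ι → ℝ) → ℝ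
  | leaf _, _ => 0
  | node e next, a => ∑ i, a i + ∑ b, cost k (next b) fun i => a i * k (e i) b

/-- The probability of deciding for a wrong message, with prior weights `a` on the messages. -/
noncomputable def err (k : X → Y → ℝ) : DecisionTree ι X Y → (ι → ℝ) → ℝ
  | leaf d, a => ∑ i, a i - a d
  | node e next, a => ∑ b, err k (next b) fun i => a i * k (e i) b

variable [Fintype X] {k : X → Y → ℝ} {C C₁ lam δ P : ℝ}

/-- A use costs `S` and raises the potential by at most `S * C₁`, so the leaf bound propagates to
the root. The message `w` stays fixed, whatever is finally decided. The penalty in `log card` is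
idle here; it makes the error coefficient agree with the communication phase. -/
theorem confirmation_phase_le [Nontrivial ι] (hk : ChannelBounds k C C₁ lam) (hδ : 0 < δ)
    (hP : 0 < P) (w : ι) (t : DecisionTree ι X Y) (a : ι → ℝ) (ha : ∀ i, 0 < a i) :
    (∑ i, a i) * ((-Real.log P + 1 - Real.log 4) / C₁)
        - (1 / (P * C₁) + Real.log (Fintype.card ι) / (δ * C)) * t.err k a
      ≤ logLikelihood a w / C₁ + t.cost k a := by
  have hC := hk.capacity_pos
  have hC₁ := hk.divergence_pos
  induction t generalizing a with
  | leaf d =>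
    simp only [err, cost]
    have hd := lt_sum_of_nontrivial ha d
    have h := div_le_div_of_nonneg_right (tangent_le_logLikelihood ha w d hP) hC₁.le
    have hl : 0 ≤ Real.log (Fintype.card ι) / (δ * C) * (∑ i, a i - a d) :=
      mul_nonneg (div_nonneg (Real.log_natCast_nonneg _) (by positivity)) (by linarith)
    have e : ((∑ i, a i) * (-Real.log P + 1 - Real.log 4) - (∑ i, a i - a d) / P) / C₁ =
      (∑ i, a i) * ((-Real.log P + 1 - Real.log 4) / C₁)
        - 1 / (P * C₁) * (∑ i, a i - a d) := by field_simp
    rw [e] at h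
    linarith
  | node e next ih =>
    simp only [err, cost]
    have h := Finset.sum_le_sum fun b (_ : b ∈ Finset.univ) =>
      ih b (fun i => a i * k (e i) b) fun i => mul_pos (ha i) (hk.pos _ _)
    rw [Finset.sum_sub_distrib, ← Finset.sum_mul, hk.sum_sum_mul, ← Finset.mul_sum,
      Finset.sum_add_distrib, ← Finset.sum_div] at h
    have h2 := div_le_div_of_nonneg_right (hk.sum_logLikelihood_le ha e w) hC₁.le
    rw [add_div, mul_div_cancel_right₀ _ hC₁.ne'] at h2
    linarith

/-- Induction up to the first node at which some posterior exceeds `1 - δ`; there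
`confirmation_phase_le` takes over. -/
theorem communication_phase_le [Nonempty X] [Nontrivial ι]
    (hk : ChannelBounds k C C₁ lam) (hδ : 0 < δ)
    (hδ' : δ ≤ 1 / 2) (hP : 0 < P) (t : DecisionTree ι X Y) (a : ι → ℝ) (ha : ∀ i, 0 < a i)
    (hmax : ∀ i, a i ≤ (1 - δ) * ∑ j, a j) :
    (∑ i, a i) * ((-Real.log P + 1 - Real.log 4 + Real.log (lam * δ)) / C₁
          - (Real.binEntropy δ + δ * Real.log (Fintype.card ι)) / C)
        - (1 / (P * C₁) + Real.log (Fintype.card ι) / (δ * C)) * t.err k a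
      ≤ negEntropy a / C + t.cost k a := by
  have hC := hk.capacity_pos
  have hC₁ := hk.divergence_pos
  have hlam := hk.lam_pos
  have hℓ : 0 ≤ Real.log (Fintype.card ι) := Real.log_natCast_nonneg _
  induction t generalizing a with
  | leaf d =>
    simp only [err, cost]
    have hS := sum_pos_of_pos ha
    have hd := lt_sum_of_nontrivial ha d
    set u := ∑ i, a i - a d with hu
    have hδu : δ * ∑ i, a i ≤ u := by have := hmax d; rw [hu]; linarith
    have hlam1 := hk.lam_le_one
    have h1 := tangent_le_neg_log (u := u) (by linarith) hS hP
    have h2 : Real.log (lam * δ) ≤ Real.log (u / ∑ i, a i) := by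
      refine Real.log_le_log (by positivity) ?_
      rw [le_div_iff₀ hS]
      nlinarith [mul_pos hδ hS]
    have h3 : 0 ≤ Real.log 4 := Real.log_nonneg (by norm_num)
    have h4 := div_le_div_of_nonneg_right (neg_mul_log_card_le_negEntropy ha) hC.le
    -- Early stopping: the error weight is at least `δ * S`, so the error penalty pays for the
    -- entropy not yet resolved.
    have h5 : (∑ i, a i) * Real.log (Fintype.card ι) / C ≤
        Real.log (Fintype.card ι) / (δ * C) * u := by
      rw [div_mul_eq_mul_div, div_le_div_iff₀ hC (by positivity)]
      nlinarith [mul_le_mul_of_nonneg_left hδu (mul_nonneg hℓ hC.le)]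
    -- No confirmation time is owed here, since `-log (u / S) ≤ -log (lam * δ)`.
    have h6 : (∑ i, a i) * ((-Real.log P + 1 - Real.log 4 + Real.log (lam * δ)) / C₁)
        - 1 / (P * C₁) * u ≤ 0 := by
      have e : (∑ i, a i) * ((-Real.log P + 1 - Real.log 4 + Real.log (lam * δ)) / C₁)
        - 1 / (P * C₁) * u = ((∑ i, a i) * (-Real.log P + 1) - u / P
          + (∑ i, a i) * (Real.log (lam * δ) - Real.log 4)) / C₁ := by field_simp; ring
      rw [e]
      refine div_nonpos_of_nonpos_of_nonneg ?_ hC₁.le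
      have := mul_le_mul_of_nonneg_left h2 hS.le
      nlinarith
    have h7 : 0 ≤ (∑ i, a i) * ((Real.binEntropy δ + δ * Real.log (Fintype.card ι)) / C) := by
      have := Real.binEntropy_nonneg hδ.le (by linarith : δ ≤ 1)
      positivity
    rw [neg_div] at h4
    linarith
  | node e next ih =>
    simp only [err, cost]
    have hchild : ∀ b,
        (∑ i, a i * k (e i) b) * ((-Real.log P + 1 - Real.log 4 + Real.log (lam * δ)) / C₁
          - (Real.binEntropy δ + δ * Real.log (Fintype.card ι)) / C)
        - (1 / (P * C₁) + Real.log (Fintype.card ι) / (δ * C)) *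
            (next b).err k (fun i => a i * k (e i) b)
      ≤ negEntropy (fun i => a i * k (e i) b) / C +
          (next b).cost k (fun i => a i * k (e i) b) := by
      intro b
      have ha' : ∀ i, 0 < a i * k (e i) b := fun i => mul_pos (ha i) (hk.pos _ _)
      by_cases hb : ∀ i, a i * k (e i) b ≤ (1 - δ) * ∑ j, a j * k (e j) b
      · exact ih b _ ha' hb
      · push Not at hb
        obtain ⟨w, hw⟩ := hb
        have hS := sum_pos_of_pos ha'
        -- No overshoot: before this output the messages other than `w` held at least the share `δ`,
        -- and the output shrinks each weight by a factor no smaller than `lam`.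
        have hlow : lam * δ * ∑ i, a i * k (e i) b ≤
            ∑ i, a i * k (e i) b - a w * k (e w) b := by
          classical
          have hS' : ∑ i, a i * k (e i) b ≤ ∑ i, a i := Finset.sum_le_sum fun i _ =>
            mul_le_of_le_one_right (ha i).le (hk.le_one _ _)
          rw [← Finset.add_sum_erase _ (fun i => a i * k (e i) b) (Finset.mem_univ w),
            add_sub_cancel_left, Finset.add_sum_erase _ (fun i => a i * k (e i) b)
              (Finset.mem_univ w)]
          have h1 : lam * ∑ i ∈ Finset.univ.erase w, a i ≤
              ∑ i ∈ Finset.univ.erase w, a i * k (e i) b := by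
            rw [Finset.mul_sum]
            refine Finset.sum_le_sum fun i _ => ?_
            rw [mul_comm]
            exact mul_le_mul_of_nonneg_left (hk.lam_le _ _) (ha i).le
          have h2 := Finset.add_sum_erase _ a (Finset.mem_univ w)
          have h3 : δ * ∑ i, a i * k (e i) b ≤ ∑ i ∈ Finset.univ.erase w, a i := by
            have := hmax w
            nlinarith
          nlinarith
        have h1 := logLikelihood_le ha' w (mul_pos hlam hδ) hlow (by nlinarith)
        have h2 := fano_le_negEntropy ha' w hδ' hw.le (lt_sum_of_nontrivial ha' w)
        have h3 := confirmation_phase_le hk hδ hP w (next b) _ ha'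
        have h1' := div_le_div_of_nonneg_right h1 hC₁.le
        have h2' := div_le_div_of_nonneg_right h2 hC.le
        have e1 : (∑ i, a i * k (e i) b) *
            ((-Real.log P + 1 - Real.log 4 + Real.log (lam * δ)) / C₁
            - (Real.binEntropy δ + δ * Real.log (Fintype.card ι)) / C)
            = (∑ i, a i * k (e i) b) * ((-Real.log P + 1 - Real.log 4) / C₁)
            - (∑ i, a i * k (e i) b) * -Real.log (lam * δ) / C₁
            + -((∑ i, a i * k (e i) b) *
              (Real.binEntropy δ + δ * Real.log (Fintype.card ι))) / C := by
          ring
        linarith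
    have h := Finset.sum_le_sum fun b (_ : b ∈ Finset.univ) => hchild b
    rw [Finset.sum_sub_distrib, ← Finset.sum_mul, hk.sum_sum_mul, ← Finset.mul_sum,
      Finset.sum_add_distrib, ← Finset.sum_div] at h
    have h2 := div_le_div_of_nonneg_right (hk.sum_negEntropy_le ha e) hC.le
    rw [add_div, mul_div_cancel_right₀ _ hC.ne'] at h2
    linarith

/-- Burnashev's bound for strategies of bounded length. -/
theorem burnashev_le_cost [Nonempty X] (hk : ChannelBounds k C C₁ lam) (hδ : 0 < δ)
    (hδ' : δ ≤ 1 / 2) {M : ℕ} (hM : 2 ≤ M) (t : DecisionTree (Fin M) X Y) (hP : 0 < P)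
    (ht : t.err k (fun _ => (M : ℝ)⁻¹) ≤ P) :
    (1 - δ - P / δ) * (Real.log M / C) + -Real.log P / C₁ - Real.binEntropy δ / C
      + (Real.log (lam * δ) - Real.log 4) / C₁ ≤ t.cost k fun _ => (M : ℝ)⁻¹ := by
  have : Nontrivial (Fin M) := Fin.nontrivial_iff_two_le.2 hM
  have hC := hk.capacity_pos
  have hC₁ := hk.divergence_pos
  have hM0 : (2 : ℝ) ≤ M := by exact_mod_cast hM
  have hS : ∑ _i : Fin M, (M : ℝ)⁻¹ = 1 := by
    simp; field_simp
  have h := communication_phase_le hk hδ hδ' hP t (fun _ => (M : ℝ)⁻¹)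
    (fun _ => by positivity) (fun _ => by
      rw [hS, mul_one]
      have : (M : ℝ)⁻¹ ≤ 2⁻¹ := inv_anti₀ (by norm_num) hM0
      linarith)
  have hE : negEntropy (fun _ : Fin M => (M : ℝ)⁻¹) = -Real.log M := by
    unfold negEntropy
    rw [hS]
    simp; field_simp
  rw [hS, hE, Fintype.card_fin] at h
  have hβ : 0 ≤ 1 / (P * C₁) + Real.log M / (δ * C) := by
    have := Real.log_natCast_nonneg M
    positivity
  have h2 := mul_le_mul_of_nonneg_left ht hβ
  have e : (1 / (P * C₁) + Real.log M / (δ * C)) * P = 1 / C₁ + P / δ * (Real.log M / C) := by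
    field_simp
  have e2 : (-Real.log P + 1 - Real.log 4 + Real.log (lam * δ)) / C₁ = -Real.log P / C₁ + 1 / C₁
    + (Real.log (lam * δ) - Real.log 4) / C₁ := by ring
  have e3 : (Real.binEntropy δ + δ * Real.log M) / C = Real.binEntropy δ / C
    + δ * (Real.log M / C) := by ring
  rw [e] at h2
  rw [one_mul, e2, e3, neg_div (C : ℝ) (Real.log M)] at h
  linarith

end DecisionTree

/-! ### Divergence, capacity and transition probabilities as finite sums -/

theorem absolutelyContinuous_of_singleton {α : Type*} [Countable α] [MeasurableSpace α]
    {μ ν : Measure α} (h : ∀ x, ν {x} = 0 → μ {x} = 0) : μ ≪ ν := by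
  refine Measure.AbsolutelyContinuous.mk fun s _ hs => ?_
  rw [← Set.biUnion_of_singleton s, measure_biUnion_null_iff s.to_countable]
  exact fun x hx => h x (measure_mono_null (Set.singleton_subset_iff.2 hx) hs)

theorem klDiv_ne_top_of_fintype {α : Type*} [Fintype α] [MeasurableSpace α]
    [MeasurableSingletonClass α] {μ ν : Measure α} [IsFiniteMeasure μ]
    (h : μ ≪ ν) : klDiv μ ν ≠ ∞ :=
  klDiv_ne_top h .of_finite

theorem toReal_klDiv_of_fintype {α : Type*} [Fintype α] [MeasurableSpace α]
    [MeasurableSingletonClass α] {μ ν : Measure α} [IsProbabilityMeasure μ]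
    [IsProbabilityMeasure ν] (h : μ ≪ ν) :
    (klDiv μ ν).toReal = ∑ x, μ.real {x} * Real.log (μ.real {x} / ν.real {x}) := by
  rw [toReal_klDiv_of_measure_eq h (by simp), integral_fintype .of_finite]
  refine Finset.sum_congr rfl fun x _ => ?_
  rw [smul_eq_mul]
  by_cases hx : ν {x} = 0
  · simp [Measure.real, h hx]
  · have h1 := Measure.setLIntegral_rnDeriv h {x}
    rw [lintegral_singleton] at h1
    have h2 : μ.real {x} / ν.real {x} = (μ.rnDeriv ν x).toReal := by
      rw [Measure.real, Measure.real, ← h1, ENNReal.toReal_mul,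
        mul_div_cancel_right₀ _ (ENNReal.toReal_ne_zero.2 ⟨hx, measure_ne_top _ _⟩)]
    rw [h2, llr]

theorem PMF.toMeasure_real_singleton {α : Type*} [MeasurableSpace α] [MeasurableSingletonClass α]
    (q : PMF α) (x : α) : q.toMeasure.real {x} = (q x).toReal := by
  rw [Measure.real, PMF.toMeasure_apply_singleton _ _ (measurableSet_singleton x)]

theorem PMF.sum_toReal {α : Type*} [Fintype α] (q : PMF α) : ∑ x, (q x).toReal = 1 := by
  rw [← ENNReal.toReal_sum fun x _ => q.apply_ne_top x, ← tsum_fintype (L := .unconditional _),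
    q.tsum_coe, ENNReal.toReal_one]

section channel

variable {X Y : Type*} {p : X → PMF Y}

/-- Finite divergence forces absolute continuity, so a zero at `(x, y)` would make `y` unreachable
from every input. -/
theorem transitionProb_pos [MeasurableSpace Y]
    [MeasurableSingletonClass Y] (h_useful : ∀ y, ∃ x, p x y ≠ 0) (hC₁ : maxInputDivergence p ≠ ∞)
    (x : X) (y : Y) : 0 < (p x y).toReal := by
  refine ENNReal.toReal_pos (fun h => ?_) ((p x).apply_ne_top y)
  obtain ⟨x', hx'⟩ := h_useful y
  have h1 : klDiv (p x').toMeasure (p x).toMeasure ≠ ∞ :=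
    ne_top_of_le_ne_top hC₁ (le_iSup₂_of_le x' x le_rfl)
  have h2 := (klDiv_ne_top_iff.1 h1).1
    ((PMF.toMeasure_apply_singleton _ _ (measurableSet_singleton y)).trans h)
  rw [PMF.toMeasure_apply_singleton _ _ (measurableSet_singleton y)] at h2
  exact hx' h2

theorem toReal_klDiv_transition [Fintype Y]
    [MeasurableSpace Y] [MeasurableSingletonClass Y] (hp : ∀ x y, 0 < (p x y).toReal) (x x' : X) :
    (klDiv (p x).toMeasure (p x').toMeasure).toReal =
      ∑ y, (p x y).toReal * Real.log ((p x y).toReal / (p x' y).toReal) := by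
  rw [toReal_klDiv_of_fintype]
  · simp_rw [PMF.toMeasure_real_singleton]
  · refine absolutelyContinuous_of_singleton fun y hy => ?_
    rw [PMF.toMeasure_apply_singleton _ _ (measurableSet_singleton y)] at hy
    exact absurd hy fun h => by simpa [h] using hp x' y

variable [Fintype X]

theorem PMF.toReal_bind (q : PMF X) (y : Y) :
    (q.bind p y).toReal = ∑ x, (q x).toReal * (p x y).toReal := by
  rw [PMF.bind_apply, tsum_fintype, ENNReal.toReal_sum fun x _ =>
    ENNReal.mul_ne_top (q.apply_ne_top x) ((p x).apply_ne_top y)]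
  simp_rw [ENNReal.toReal_mul]

variable [Fintype Y]

theorem jointLaw_apply (q : PMF X) (x : X) (y : Y) :
    (q.bind fun x => (p x).map fun y => (x, y)) (x, y) = q x * p x y := by
  classical
  simp [PMF.bind_apply, PMF.map_apply, tsum_fintype, Prod.ext_iff, Finset.sum_ite_eq, ite_and]

theorem minTransitionProb_le (x : X) (y : Y) : minTransitionProb p ≤ (p x y).toReal :=
  ciInf_le (f := fun xy : X × Y => (p xy.1 xy.2).toReal) (Set.finite_range _).bddBelow (x, y)

theorem minTransitionProb_pos [Nonempty X] (hp : ∀ x y, 0 < (p x y).toReal) :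
    0 < minTransitionProb p := by
  obtain ⟨x⟩ := ‹Nonempty X›
  obtain ⟨y, -⟩ := (p x).support_nonempty
  have : Nonempty (X × Y) := ⟨(x, y)⟩
  obtain ⟨z, hz⟩ := exists_eq_ciInf_of_finite (f := fun xy : X × Y => (p xy.1 xy.2).toReal)
  rw [minTransitionProb, ← hz]
  exact hp _ _

variable [MeasurableSpace Y] [MeasurableSingletonClass Y]

variable [MeasurableSpace X] [MeasurableSingletonClass X]

theorem jointLaw_absolutelyContinuous (p : X → PMF Y) (q : PMF X) :
    (q.bind fun x => (p x).map fun y => (x, y)).toMeasure ≪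
      q.toMeasure.prod (q.bind p).toMeasure := by
  refine absolutelyContinuous_of_singleton fun z hz => ?_
  obtain ⟨x, y⟩ := z
  rw [PMF.toMeasure_apply_singleton _ _ (measurableSet_singleton _), jointLaw_apply]
  rw [← Set.singleton_prod_singleton, Measure.prod_prod,
    PMF.toMeasure_apply_singleton _ _ (measurableSet_singleton _),
    PMF.toMeasure_apply_singleton _ _ (measurableSet_singleton _)] at hz
  rcases mul_eq_zero.1 hz with h | h
  · rw [h, zero_mul]
  · rw [PMF.bind_apply, ENNReal.tsum_eq_zero] at h
    exact h x

theorem mutualInfo_ne_top (p : X → PMF Y) (q : PMF X) : mutualInfo p q ≠ ∞ :=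
  klDiv_ne_top_of_fintype (jointLaw_absolutelyContinuous p q)

theorem toReal_mutualInfo (p : X → PMF Y) (q : PMF X) :
    (mutualInfo p q).toReal = ∑ x, (q x).toReal * ∑ y, (p x y).toReal *
      Real.log ((p x y).toReal / ∑ x', (q x').toReal * (p x' y).toReal) := by
  rw [mutualInfo, toReal_klDiv_of_fintype (jointLaw_absolutelyContinuous p q),
    Fintype.sum_prod_type]
  refine Finset.sum_congr rfl fun x _ => ?_
  rw [Finset.mul_sum]
  refine Finset.sum_congr rfl fun y _ => ?_
  rw [PMF.toMeasure_real_singleton, jointLaw_apply, ← Set.singleton_prod_singleton,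
    measureReal_prod_prod, PMF.toMeasure_real_singleton, PMF.toMeasure_real_singleton,
    PMF.toReal_bind, ENNReal.toReal_mul]
  by_cases hq : (q x).toReal = 0
  · simp [hq]
  · rw [mul_div_mul_left _ _ hq, mul_assoc]

/-- Every output law is at least `minTransitionProb p` pointwise, so every mutual information is at
most `-log (minTransitionProb p)`. -/
theorem channelCapacity_ne_top [Nonempty X] (hp : ∀ x y, 0 < (p x y).toReal) :
    channelCapacity p ≠ ∞ := by
  have hl := minTransitionProb_pos hp
  refine ne_top_of_le_ne_top (ENNReal.ofReal_ne_top (r := -Real.log (minTransitionProb p)))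
    (iSup_le fun q => ?_)
  rw [← ENNReal.ofReal_toReal (mutualInfo_ne_top p q), toReal_mutualInfo p]
  refine ENNReal.ofReal_le_ofReal ?_
  have h1 : ∀ y, minTransitionProb p ≤ ∑ x', (q x').toReal * (p x' y).toReal := fun y => by
    calc minTransitionProb p = ∑ x', (q x').toReal * minTransitionProb p := by
          rw [← Finset.sum_mul, q.sum_toReal, one_mul]
      _ ≤ _ := Finset.sum_le_sum fun x' _ =>
          mul_le_mul_of_nonneg_left (minTransitionProb_le x' y) ENNReal.toReal_nonneg
  calc _ ≤ ∑ x, (q x).toReal * ∑ y, (p x y).toReal * -Real.log (minTransitionProb p) := by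
        refine Finset.sum_le_sum fun x _ => mul_le_mul_of_nonneg_left
          (Finset.sum_le_sum fun y _ => mul_le_mul_of_nonneg_left ?_ (hp x y).le)
          ENNReal.toReal_nonneg
        rw [Real.log_div (hp x y).ne' (hl.trans_le (h1 y)).ne']
        have h2 := Real.log_le_log hl (h1 y)
        have h3 : (p x y).toReal ≤ 1 :=
          ENNReal.toReal_le_of_le_ofReal zero_le_one (by simpa using (p x).coe_le_one y)
        have h4 := Real.log_nonpos (hp x y).le h3
        linarith
    _ = _ := by simp_rw [← Finset.sum_mul, (p _).sum_toReal, one_mul]; rw [← Finset.sum_mul,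
                  q.sum_toReal, one_mul]

/-- If all divergences vanish, all rows coincide, the output is independent of the input and the
capacity is zero. -/
theorem maxInputDivergence_pos (hp : ∀ x y, 0 < (p x y).toReal) (hC : 0 < channelCapacity p) :
    0 < maxInputDivergence p := by
  by_contra h0
  have h0 : maxInputDivergence p = 0 := by simpa using h0
  have heq : ∀ x x', p x = p x' := fun x x' => by
    have h : klDiv (p x).toMeasure (p x').toMeasure = 0 :=
      le_antisymm (h0 ▸ le_iSup₂_of_le (f := fun x x' => klDiv (p x).toMeasure (p x').toMeasure)
        x x' le_rfl) bot_le
    exact PMF.toMeasure_inj.1 (klDiv_eq_zero_iff.1 h)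
  refine hC.ne' (le_antisymm (iSup_le fun q => ?_) bot_le)
  rw [← ENNReal.ofReal_toReal (mutualInfo_ne_top p q), toReal_mutualInfo p]
  refine le_of_eq (ENNReal.ofReal_eq_zero.2 (le_of_eq (Finset.sum_eq_zero fun x _ => ?_)))
  refine mul_eq_zero_of_right _ (Finset.sum_eq_zero fun y _ => ?_)
  have : ∑ x', (q x').toReal * (p x' y).toReal = (p x y).toReal := by
    simp_rw [fun x' => heq x' x]
    rw [← Finset.sum_mul, q.sum_toReal, one_mul]
  rw [this, div_self (hp x y).ne', Real.log_one, mul_zero]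

theorem channelBounds [Nonempty X] (h_useful : ∀ y, ∃ x, p x y ≠ 0)
    (hC₁ : maxInputDivergence p ≠ ∞) (hC : 0 < channelCapacity p) :
    ChannelBounds (fun x y => (p x y).toReal) (channelCapacity p).toReal
      (maxInputDivergence p).toReal (minTransitionProb p) := by
  have hp := transitionProb_pos h_useful hC₁
  have hCtop := channelCapacity_ne_top hp
  refine ⟨ENNReal.toReal_pos hC.ne' hCtop,
    ENNReal.toReal_pos (maxInputDivergence_pos hp hC).ne' hC₁, minTransitionProb_pos hp,
    minTransitionProb_le, fun x => (p x).sum_toReal, fun q hq hq1 => ?_, fun x x' => ?_⟩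
  · have hq1' : ∑ x, ENNReal.ofReal (q x) = 1 := by
      rw [← ENNReal.ofReal_sum_of_nonneg fun x _ => hq x, hq1, ENNReal.ofReal_one]
    have h := ENNReal.toReal_mono hCtop
      (le_iSup (mutualInfo p) (PMF.ofFintype (fun x => ENNReal.ofReal (q x)) hq1'))
    rw [toReal_mutualInfo p] at h
    simpa only [PMF.ofFintype_apply, ENNReal.toReal_ofReal (hq _)] using h
  · rw [← toReal_klDiv_transition hp]
    exact ENNReal.toReal_mono hC₁ (le_iSup₂_of_le x x' le_rfl)

end channel

/-! ### Truncating a code to a decision tree -/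

/-- Cylinder events are preimages under restriction to `Δ`. Only this set-theoretic fact matters, so
the target may carry the σ-algebra `⊤`. -/
theorem mem_iff_of_measurableSet_cylinderEvents {ι : Type*} {X : ι → Type*}
    [∀ i, MeasurableSpace (X i)] {Δ : Set ι} {s : Set (∀ i, X i)}
    (hs : MeasurableSet[cylinderEvents Δ] s) {z z' : ∀ i, X i} (h : ∀ i ∈ Δ, z i = z' i) :
    z ∈ s ↔ z' ∈ s := by
  have hle : cylinderEvents (X := X) Δ ≤
      MeasurableSpace.comap (fun (z : ∀ i, X i) (i : Δ) => z i) ⊤ := by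
    refine iSup₂_le fun i hi => ?_
    rintro _ ⟨u, -, rfl⟩
    exact ⟨{f | f ⟨i, hi⟩ ∈ u}, trivial, rfl⟩
  obtain ⟨u, -, rfl⟩ := hle s hs
  have : (fun i : Δ => z i) = fun i : Δ => z' i := funext fun i => h i i.2
  simp only [Set.mem_preimage, this]

namespace FeedbackCode

variable {X Y : Type*} [MeasurableSpace Y] {M : ℕ} (c : FeedbackCode X Y M)

theorem decodingTime_le_iff {n : ℕ} {z z' : ℕ → Y} (h : ∀ i < n, z i = z' i) :
    c.decodingTime z ≤ n ↔ c.decodingTime z' ≤ n :=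
  mem_iff_of_measurableSet_cylinderEvents (c.isStoppingTime n) h

theorem decode_eq {n : ℕ} {z z' : ℕ → Y} (h : ∀ i < n, z i = z' i)
    (hn : c.decodingTime z ≤ n) : c.decode z = c.decode z' := by
  have h1 := (c.measurable_decode (measurableSet_singleton (c.decode z))).2 n
  have h2 := (mem_iff_of_measurableSet_cylinderEvents h1 h).1 ⟨rfl, hn⟩
  exact h2.1.symm

/-- The code stops after the outputs `y` at the latest. -/
def Stops (n : ℕ) (y : Fin n → Y) : Prop :=
  ∃ z : ℕ → Y, (∀ i : Fin n, z i = y i) ∧ c.decodingTime z ≤ n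

open Classical in
/-- The message decoded after the outputs `y`, and `d₀` if the code has not stopped. -/
noncomputable def decision (d₀ : Fin M) (n : ℕ) (y : Fin n → Y) : Fin M :=
  if h : c.Stops n y then c.decode h.choose else d₀

theorem decodingTime_le_iff_stops {n : ℕ} {y : Fin n → Y} {z : ℕ → Y}
    (hz : ∀ i : Fin n, z i = y i) : c.decodingTime z ≤ n ↔ c.Stops n y := by
  refine ⟨fun h => ⟨z, hz, h⟩, fun ⟨z', hz', h⟩ => ?_⟩
  exact (c.decodingTime_le_iff fun i hi => (hz' ⟨i, hi⟩).trans (hz ⟨i, hi⟩).symm).1 h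

theorem decode_eq_decision (d₀ : Fin M) {n : ℕ} {y : Fin n → Y} (h : c.Stops n y) {z : ℕ → Y}
    (hz : ∀ i : Fin n, z i = y i) : c.decode z = c.decision d₀ n y := by
  rw [decision, dif_pos h]
  exact (c.decode_eq (fun i hi => (h.choose_spec.1 ⟨i, hi⟩).trans (hz ⟨i, hi⟩).symm)
    h.choose_spec.2).symm

open Classical in
/-- The code continued for at most `N` more channel uses after the outputs `y`. -/
noncomputable def truncate (d₀ : Fin M) : (N n : ℕ) → (Fin n → Y) → DecisionTree (Fin M) X Y
  | 0, n, y => .leaf (c.decision d₀ n y)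
  | N + 1, n, y =>
    if c.Stops n y then .leaf (c.decision d₀ n y)
    else .node (fun w => c.encode n w y) fun b => truncate d₀ N (n + 1) (Fin.snoc y b)

end FeedbackCode

/-! ### Splitting along the next output, and comparing a code with its truncation -/

theorem sum_measureReal_inter_preimage_singleton {Ω β : Type*} [MeasurableSpace Ω] [Fintype β]
    [MeasurableSpace β] [MeasurableSingletonClass β] {μ : Measure Ω} [IsFiniteMeasure μ]
    {g : Ω → β} (hg : Measurable g) (s : Set Ω) :
    ∑ b, μ.real (g ⁻¹' {b} ∩ s) = μ.real s := by
  have h := sum_measureReal_preimage_singleton (μ := μ.restrict s) Finset.univ (f := g)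
    fun b _ => hg (measurableSet_singleton b)
  simpa [measureReal_restrict_apply (hg (measurableSet_singleton _))] using h

theorem sum_setLIntegral_inter_preimage_singleton {Ω β : Type*} [MeasurableSpace Ω] [Fintype β]
    [MeasurableSpace β] [MeasurableSingletonClass β] {μ : Measure Ω}
    {g : Ω → β} (hg : Measurable g) {s : Set Ω} (hs : MeasurableSet s) (f : Ω → ℝ≥0∞) :
    ∑ b, ∫⁻ ω in g ⁻¹' {b} ∩ s, f ω ∂μ = ∫⁻ ω in s, f ω ∂μ := by
  have h := lintegral_iUnion (μ := μ) (s := fun b => g ⁻¹' {b} ∩ s)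
    (fun b => (hg (measurableSet_singleton b)).inter hs)
    (fun b b' hb => Set.disjoint_left.2 fun ω h1 h2 => hb (by
      rw [← show g ω = b from h1.1, ← show g ω = b' from h2.1])) f
  rw [tsum_fintype] at h
  rw [← h]
  congr 2
  ext ω
  simp

theorem outputs_snoc {Ω Y : Type*} (Z : ℕ → Ω → Y) (n : ℕ) (y : Fin n → Y) (b : Y) :
    {ω | ∀ i : Fin (n + 1), Z i ω = (Fin.snoc y b : Fin (n + 1) → Y) i} =
      Z n ⁻¹' {b} ∩ {ω | ∀ i : Fin n, Z i ω = y i} := by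
  ext ω
  simp [Fin.forall_fin_succ', and_comm]

namespace IsTransmission

variable {X Y Ω : Type*} [MeasurableSpace Y] [MeasurableSpace Ω] {M : ℕ}
  {p : X → PMF Y} {c : FeedbackCode X Y M} {μ : Measure Ω}
  {W : Ω → Fin M} {Z : ℕ → Ω → Y}

theorem measureReal_snoc (h : IsTransmission p c μ W Z) (n : ℕ) (w : Fin M) (y : Fin n → Y)
    (b : Y) :
    μ.real {ω | W ω = w ∧ ∀ i : Fin (n + 1), Z i ω = (Fin.snoc y b : Fin (n + 1) → Y) i} =
      μ.real {ω | W ω = w ∧ ∀ i : Fin n, Z i ω = y i} * (p (c.encode n w y) b).toReal := by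
  rw [Measure.real, Measure.real, ← ENNReal.toReal_mul, ← h.output_law]
  congr 3
  ext ω
  simp [Fin.forall_fin_succ']

theorem measureReal_zero (h : IsTransmission p c μ W Z) (w : Fin M) (y : Fin 0 → Y) :
    μ.real {ω | W ω = w ∧ ∀ i : Fin 0, Z i ω = y i} = (M : ℝ)⁻¹ := by
  have := h.message_uniform w
  simp [Measure.real, this]

theorem measureReal_pos (h : IsTransmission p c μ W Z) (hp : ∀ x y, 0 < (p x y).toReal)
    (n : ℕ) (w : Fin M) (y : Fin n → Y) :
    0 < μ.real {ω | W ω = w ∧ ∀ i : Fin n, Z i ω = y i} := by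
  induction n with
  | zero =>
    rw [h.measureReal_zero]
    have : 0 < M := w.pos
    positivity
  | succ n ih =>
    rw [← Fin.snoc_init_self (α := fun _ => Y) y, h.measureReal_snoc]
    exact mul_pos (ih _) (hp _ _)

theorem sum_measureReal_outputs [IsFiniteMeasure μ] (h : IsTransmission p c μ W Z)
    (n : ℕ) (y : Fin n → Y) :
    ∑ w, μ.real {ω | W ω = w ∧ ∀ i : Fin n, Z i ω = y i} =
      μ.real {ω | ∀ i : Fin n, Z i ω = y i} :=
  sum_measureReal_inter_preimage_singleton h.measurable_message _

variable [MeasurableSingletonClass Y]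

theorem measurableSet_outputs (h : IsTransmission p c μ W Z) (n : ℕ) (y : Fin n → Y) :
    MeasurableSet {ω | ∀ i : Fin n, Z i ω = y i} := by
  rw [Set.ofPred_forall]
  exact MeasurableSet.iInter fun i => h.measurable_output i (measurableSet_singleton _)

variable [Fintype Y] [IsProbabilityMeasure μ]

/-- Truncation only shortens the code. The term in `n` accounts for the uses before `y`, which
`decodingTime` counts and the tree does not. -/
theorem truncate_cost_le (h : IsTransmission p c μ W Z) (d₀ : Fin M) (N n : ℕ) (y : Fin n → Y)
    (hy : ∀ z : ℕ → Y, (∀ i : Fin n, z i = y i) → (n : ℕ∞) ≤ c.decodingTime z) :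
    ENNReal.ofReal ((c.truncate d₀ N n y).cost (fun x y => (p x y).toReal)
        fun w => μ.real {ω | W ω = w ∧ ∀ i : Fin n, Z i ω = y i})
      + n * μ {ω | ∀ i : Fin n, Z i ω = y i} ≤
      ∫⁻ ω in {ω | ∀ i : Fin n, Z i ω = y i}, (c.decodingTime fun n => Z n ω : ℝ≥0∞) ∂μ := by
  have hfloor : ∀ (n : ℕ) (y : Fin n → Y),
      (∀ z : ℕ → Y, (∀ i : Fin n, z i = y i) → (n : ℕ∞) ≤ c.decodingTime z) →
      (n : ℝ≥0∞) * μ {ω | ∀ i : Fin n, Z i ω = y i} ≤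
      ∫⁻ ω in {ω | ∀ i : Fin n, Z i ω = y i}, (c.decodingTime fun n => Z n ω : ℝ≥0∞) ∂μ := by
    intro n y hm
    rw [← setLIntegral_const]
    refine setLIntegral_mono' (h.measurableSet_outputs n y) fun ω hω => ?_
    exact_mod_cast ENat.toENNReal_le.2 (hm (fun n => Z n ω) hω)
  induction N generalizing n with
  | zero => simpa [FeedbackCode.truncate, DecisionTree.cost] using hfloor n y hy
  | succ N ih =>
    rw [FeedbackCode.truncate]
    split_ifs with hs
    · simpa [DecisionTree.cost] using hfloor n y hy
    · have hy' : ∀ z : ℕ → Y, (∀ i : Fin n, z i = y i) → ((n + 1 : ℕ) : ℕ∞) ≤ c.decodingTime z := by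
        intro z hz
        have := (c.decodingTime_le_iff_stops hz).not.2 hs
        push_cast
        exact Order.add_one_le_of_lt (not_le.1 this)
      have ih' := fun b => ih (n + 1) (Fin.snoc y b)
        (fun z hz => hy' z fun i => by simpa using hz i.castSucc)
      simp_rw [h.measureReal_snoc, outputs_snoc] at ih'
      have ih'' := Finset.sum_le_sum fun b (_ : b ∈ Finset.univ) => ih' b
      rw [sum_setLIntegral_inter_preimage_singleton (h.measurable_output n)
        (h.measurableSet_outputs n y), Finset.sum_add_distrib, ← Finset.mul_sum] at ih''
      have hμ := sum_setLIntegral_inter_preimage_singleton (μ := μ) (h.measurable_output n)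
        (h.measurableSet_outputs n y) 1
      simp only [Pi.one_apply, setLIntegral_one] at hμ
      rw [hμ] at ih''
      refine le_trans ?_ ih''
      rw [DecisionTree.cost, h.sum_measureReal_outputs]
      -- Subadditivity of `ENNReal.ofReal` is in the needed direction, so the costs need not be
      -- shown nonnegative.
      calc _ ≤ (ENNReal.ofReal (μ.real {ω | ∀ i : Fin n, Z i ω = y i}) + ∑ b, ENNReal.ofReal _)
            + n * μ {ω | ∀ i : Fin n, Z i ω = y i} := by
            gcongr
            exact ENNReal.ofReal_add_le.trans (add_le_add_right
              (Finset.le_sum_of_subadditive _ ENNReal.ofReal_zero.le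
                (fun _ _ => ENNReal.ofReal_add_le) _ _) _)
        _ = _ := by
            rw [ofReal_measureReal]
            push_cast
            ring

/-- A leaf where the code has stopped errs only when the code does; a leaf forced by the depth limit
lies inside the event that `decodingTime` exceeds `n + N`. -/
theorem truncate_err_le (h : IsTransmission p c μ W Z) (d₀ : Fin M) (N n : ℕ) (y : Fin n → Y) :
    (c.truncate d₀ N n y).err (fun x y => (p x y).toReal)
        (fun w => μ.real {ω | W ω = w ∧ ∀ i : Fin n, Z i ω = y i}) ≤
      μ.real ({ω | ∀ i : Fin n, Z i ω = y i} ∩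
        ({ω | c.decodingTime (fun n => Z n ω) = ⊤ ∨ c.decode (fun n => Z n ω) ≠ W ω} ∪
          {ω | ((n + N : ℕ) : ℕ∞) < c.decodingTime fun n => Z n ω})) := by
  have hleaf : ∀ (N n : ℕ) (y : Fin n → Y), c.Stops n y ∨ N = 0 →
      (DecisionTree.leaf (c.decision d₀ n y)).err (fun x y => (p x y).toReal)
        (fun w => μ.real {ω | W ω = w ∧ ∀ i : Fin n, Z i ω = y i}) ≤
      μ.real ({ω | ∀ i : Fin n, Z i ω = y i} ∩
        ({ω | c.decodingTime (fun n => Z n ω) = ⊤ ∨ c.decode (fun n => Z n ω) ≠ W ω} ∪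
          {ω | ((n + N : ℕ) : ℕ∞) < c.decodingTime fun n => Z n ω})) := by
    intro N n y hN
    rw [DecisionTree.err, h.sum_measureReal_outputs, sub_le_iff_le_add']
    refine (measureReal_mono ?_).trans (measureReal_union_le _ _)
    intro ω hω
    by_cases hW : W ω = c.decision d₀ n y
    · exact Or.inl ⟨hW, hω⟩
    · refine Or.inr ⟨hω, ?_⟩
      by_cases hs : c.Stops n y
      · refine Or.inl (Or.inr ?_)
        rw [c.decode_eq_decision d₀ hs (z := fun n => Z n ω) hω]
        exact fun h => hW h.symm
      · right
        rw [Set.mem_ofPred_eq, hN.resolve_left hs, add_zero]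
        exact not_le.1 ((c.decodingTime_le_iff_stops (z := fun n => Z n ω) hω).not.2 hs)
  induction N generalizing n with
  | zero => exact hleaf 0 n y (Or.inr rfl)
  | succ N ih =>
    rw [FeedbackCode.truncate]
    split_ifs with hs
    · exact hleaf _ n y (Or.inl hs)
    · rw [DecisionTree.err, ← sum_measureReal_inter_preimage_singleton (h.measurable_output n)]
      refine Finset.sum_le_sum fun b _ => ?_
      have ih' := ih (n + 1) (Fin.snoc y b)
      simp_rw [h.measureReal_snoc] at ih'
      rw [outputs_snoc, Set.inter_assoc, show n + 1 + N = n + (N + 1) by ring] at ih'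
      exact ih'

end IsTransmission

/-! ### Burnashev's bound -/

namespace IsTransmission

variable {X Y Ω : Type*} [MeasurableSpace Y] [MeasurableSpace Ω] {M : ℕ}
  {p : X → PMF Y} {c : FeedbackCode X Y M} {μ : Measure Ω}
  {W : Ω → Fin M} {Z : ℕ → Ω → Y}

theorem measurableSet_lt_decodingTime (h : IsTransmission p c μ W Z) (N : ℕ) :
    MeasurableSet {ω | (N : ℕ∞) < c.decodingTime fun n => Z n ω} := by
  have h1 : MeasurableSet {z : ℕ → Y | c.decodingTime z ≤ N} :=
    (outputFiltration Y).le N _ (c.isStoppingTime N)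
  have h2 := (measurable_pi_lambda (fun ω n => Z n ω) h.measurable_output) h1.compl
  convert h2 using 1
  ext ω
  exact (not_le (a := c.decodingTime fun n => Z n ω) (b := (N : ℕ∞))).symm

theorem measureReal_lt_decodingTime_le (h : IsTransmission p c μ W Z)
    (hT : expectedTime c μ Z ≠ ∞) (N : ℕ) :
    μ.real {ω | (N : ℕ∞) < c.decodingTime fun n => Z n ω} ≤
      (expectedTime c μ Z).toReal / (N + 1) := by
  rw [le_div_iff₀ (by positivity)]
  have h1 : ((N + 1 : ℕ) : ℝ≥0∞) * μ {ω | (N : ℕ∞) < c.decodingTime fun n => Z n ω} ≤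
      expectedTime c μ Z := by
    rw [← setLIntegral_const]
    refine le_trans ?_ (setLIntegral_le_lintegral {ω | (N : ℕ∞) < c.decodingTime fun n => Z n ω} _)
    refine setLIntegral_mono' (h.measurableSet_lt_decodingTime N) fun ω hω => ?_
    have : ((N + 1 : ℕ) : ℕ∞) ≤ c.decodingTime fun n => Z n ω := by
      push_cast
      exact Order.add_one_le_of_lt hω
    exact_mod_cast ENat.toENNReal_le.2 this
  have h2 := ENNReal.toReal_mono hT h1
  rw [ENNReal.toReal_mul, ENNReal.toReal_natCast, mul_comm] at h2
  exact_mod_cast h2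

variable [IsProbabilityMeasure μ]

/-- Every output string has positive probability under every message, so wherever the code stops,
each message not decoded there contributes an error. A code that never stops always errs. -/
theorem errorProb_pos (h : IsTransmission p c μ W Z) (hp : ∀ x y, 0 < (p x y).toReal)
    (hM : 2 ≤ M) : 0 < errorProb c μ W Z := by
  have hnt : Nontrivial (Fin M) := Fin.nontrivial_iff_two_le.2 hM
  by_cases hs : ∃ n, ∃ y, c.Stops n y
  · obtain ⟨n, y, hs⟩ := hs
    obtain ⟨w, hw⟩ := exists_ne (c.decision ⟨0, by omega⟩ n y)
    refine (h.measureReal_pos hp n w y).trans_le (measureReal_mono fun ω hω => Or.inr ?_)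
    rw [c.decode_eq_decision ⟨0, by omega⟩ hs (z := fun n => Z n ω) hω.2, hω.1]
    exact hw.symm
  · have : ∀ z, c.decodingTime z = ⊤ := fun z => by
      by_contra hz
      obtain ⟨n, hn⟩ := ENat.ne_top_iff_exists.1 hz
      exact hs ⟨n, fun i => z i, z, fun _ => rfl, hn.symm.le⟩
    simp [errorProb, this]

variable [MeasurableSingletonClass Y] [Fintype Y]

/-- The tree bound is applied with `P = Pe + τ N`. Markov's inequality gives `τ N → 0`, and the
bound is continuous in `P` at `Pe > 0`. -/
theorem burnashev_le_expectedTime [Fintype X] [Nonempty X] {C C₁ lam δ : ℝ}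
    (hk : ChannelBounds (fun x y => (p x y).toReal) C C₁ lam)
    (h : IsTransmission p c μ W Z) (hM : 2 ≤ M) (hδ : 0 < δ) (hδ' : δ ≤ 1 / 2) :
    (((1 - δ - errorProb c μ W Z / δ) * (Real.log M / C) + -Real.log (errorProb c μ W Z) / C₁
        - Real.binEntropy δ / C + (Real.log (lam * δ) - Real.log 4) / C₁ : ℝ) : EReal)
      ≤ (expectedTime c μ Z : EReal) := by
  by_cases hT : expectedTime c μ Z = ∞
  · rw [hT]; exact le_top
  rw [← ENNReal.ofReal_toReal hT, EReal.coe_ennreal_ofReal, max_eq_left ENNReal.toReal_nonneg,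
    EReal.coe_le_coe_iff]
  have hPe := h.errorProb_pos hk.pos hM
  set Pe := errorProb c μ W Z with hPe'
  set τ : ℕ → ℝ := fun N => μ.real {ω | (N : ℕ∞) < c.decodingTime fun n => Z n ω} with hτ
  have hτ0 : Tendsto (fun N => Pe + τ N) atTop (𝓝 Pe) := by
    have h0 : Tendsto τ atTop (𝓝 0) := by
      refine squeeze_zero (fun N => measureReal_nonneg) (h.measureReal_lt_decodingTime_le hT) ?_
      have := (tendsto_one_div_add_atTop_nhds_zero_nat (𝕜 := ℝ)).const_mul
        (expectedTime c μ Z).toReal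
      simpa [div_eq_mul_inv] using this
    simpa using h0.const_add Pe
  have hbound : ∀ N, (1 - δ - (Pe + τ N) / δ) * (Real.log M / C) + -Real.log (Pe + τ N) / C₁
      - Real.binEntropy δ / C + (Real.log (lam * δ) - Real.log 4) / C₁ ≤
      (expectedTime c μ Z).toReal := by
    intro N
    have hτN : 0 ≤ τ N := measureReal_nonneg
    have hcost := h.truncate_cost_le ⟨0, by omega⟩ N 0 Fin.elim0 (by simp)
    have herr := h.truncate_err_le ⟨0, by omega⟩ N 0 Fin.elim0
    simp_rw [h.measureReal_zero] at hcost herr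
    refine (DecisionTree.burnashev_le_cost hk hδ hδ' hM
      (c.truncate ⟨0, by omega⟩ N 0 Fin.elim0) (P := Pe + τ N) (by linarith) ?_).trans ?_
    · refine herr.trans ((measureReal_mono Set.inter_subset_right).trans
        ((measureReal_union_le _ _).trans ?_))
      rw [zero_add]
      exact le_rfl
    · rw [← ENNReal.ofReal_le_iff_le_toReal hT]
      simpa [expectedTime] using hcost
  have hcont : ContinuousAt (fun P : ℝ => (1 - δ - P / δ) * (Real.log M / C) + -Real.log P / C₁
      - Real.binEntropy δ / C + (Real.log (lam * δ) - Real.log 4) / C₁) Pe := by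
    have := Real.continuousAt_log hPe.ne'
    fun_prop
  exact le_of_tendsto' (hcont.tendsto.comp hτ0) hbound

end IsTransmission

/-! ### The asymptotic form -/

/-- The relative loss in Burnashev's bound at error probability `t`, obtained with
`δ = 1 / log (1 / t)`. -/
noncomputable def burnashevLoss (C C₁ lam t : ℝ) : ℝ :=
  if 0 < t ∧ 2 ≤ -Real.log t then
    (-Real.log t)⁻¹ + t * -Real.log t +
      (Real.log 2 * (C₁ / C) + Real.log 4 - Real.log lam + Real.log (-Real.log t)) / -Real.log t
  else 1

theorem burnashevLoss_pos {C C₁ lam : ℝ} (hC : 0 < C) (hC₁ : 0 < C₁) (hlam : 0 < lam)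
    (hlam' : lam ≤ 1) (t : ℝ) : 0 < burnashevLoss C C₁ lam t := by
  unfold burnashevLoss
  split_ifs with h
  · obtain ⟨ht, hL⟩ := h
    have h1 := Real.log_nonpos hlam.le hlam'
    have h2 := Real.log_nonneg (by linarith : 1 ≤ -Real.log t)
    have h3 := Real.log_nonneg (by norm_num : (1 : ℝ) ≤ 2)
    have h4 := Real.log_nonneg (by norm_num : (1 : ℝ) ≤ 4)
    have h5 : 0 ≤ Real.log 2 * (C₁ / C) := by positivity
    have hL0 : 0 < -Real.log t := by linarith
    have h6 : 0 ≤ (Real.log 2 * (C₁ / C) + Real.log 4 - Real.log lam + Real.log (-Real.log t))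
      / -Real.log t := div_nonneg (by linarith) hL0.le
    have := inv_pos.2 hL0
    have := mul_pos ht hL0
    linarith
  · exact one_pos

theorem tendsto_burnashevLoss (C C₁ lam : ℝ) :
    Tendsto (burnashevLoss C C₁ lam) (𝓝[>] 0) (𝓝 0) := by
  have hL : Tendsto (fun t => -Real.log t) (𝓝[>] 0) atTop :=
    tendsto_neg_atBot_atTop.comp Real.tendsto_log_nhdsGT_zero
  have h1 : Tendsto (fun t => (-Real.log t)⁻¹) (𝓝[>] 0) (𝓝 0) := tendsto_inv_atTop_zero.comp hL
  have h2 : Tendsto (fun t => t * -Real.log t) (𝓝[>] 0) (𝓝 0) := by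
    have := (Real.continuous_negMulLog.tendsto 0).mono_left (nhdsWithin_le_nhds (s := Set.Ioi 0))
    rw [Real.negMulLog_zero] at this
    exact this.congr fun t => by rw [Real.negMulLog]; ring
  have h3 : Tendsto (fun t => Real.log (-Real.log t) / -Real.log t) (𝓝[>] 0) (𝓝 0) :=
    Real.isLittleO_log_id_atTop.tendsto_div_nhds_zero.comp hL
  have h4 := (h1.add h2).add
    ((h1.const_mul (Real.log 2 * (C₁ / C) + Real.log 4 - Real.log lam)).add h3)
  simp only [mul_zero, add_zero] at h4
  refine h4.congr' ?_
  filter_upwards [self_mem_nhdsWithin, hL.eventually_ge_atTop 2] with t ht ht2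
  rw [burnashevLoss, if_pos ⟨ht, ht2⟩]
  ring

/-- With `L = -log t` and `δ = 1 / L`, the losses `1 / L` and `t * L` are `δ` and `t / δ`. The
remaining constants total at most `D / C₁`, which is the fraction `D / L` of `L / C₁`. The cross
terms `h6` and `h7` have the favourable sign. -/
theorem mul_one_sub_burnashevLoss_le {C C₁ lam ℓ t : ℝ} (hC : 0 < C) (hC₁ : 0 < C₁)
    (hlam : 0 < lam) (hlam' : lam ≤ 1) (hℓ : 0 ≤ ℓ) (ht : 0 < t) (ht2 : 2 ≤ -Real.log t) :
    (ℓ / C - Real.log t / C₁) * (1 - burnashevLoss C C₁ lam t) ≤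
      (1 - (-Real.log t)⁻¹ - t / (-Real.log t)⁻¹) * (ℓ / C) + -Real.log t / C₁
        - Real.binEntropy (-Real.log t)⁻¹ / C
        + (Real.log (lam * (-Real.log t)⁻¹) - Real.log 4) / C₁ := by
  rw [burnashevLoss, if_pos ⟨ht, ht2⟩]
  set L := -Real.log t with hL
  have hL0 : 0 < L := by linarith
  have h1 := Real.log_nonpos hlam.le hlam'
  have h2 := Real.log_nonneg (by linarith : 1 ≤ L)
  have h3 := Real.log_nonneg (by norm_num : (1 : ℝ) ≤ 2)
  have h4 := Real.log_nonneg (by norm_num : (1 : ℝ) ≤ 4)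
  have h5 : 0 ≤ Real.log 2 * (C₁ / C) := by positivity
  have hb : Real.binEntropy L⁻¹ / C ≤ Real.log 2 / C :=
    div_le_div_of_nonneg_right Real.binEntropy_le_log_two hC.le
  set D := Real.log 2 * (C₁ / C) + Real.log 4 - Real.log lam + Real.log L with hD
  have hD0 : 0 ≤ D := by linarith
  have e1 : Real.log t / C₁ = -(L / C₁) := by rw [hL]; ring
  have e2 : (Real.log (lam * L⁻¹) - Real.log 4) / C₁ = Real.log 2 / C - D / C₁ := by
    rw [Real.log_mul hlam.ne' (inv_pos.2 hL0).ne', Real.log_inv, hD]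
    field_simp
    ring
  have e3 : L / C₁ * (D / L) = D / C₁ := by field_simp
  have h6 : 0 ≤ ℓ / C * (D / L) := by positivity
  have h7 : 0 ≤ L / C₁ * (L⁻¹ + t * L) := by positivity
  rw [e1, e2, div_inv_eq_mul]
  nlinarith

theorem mainTheorem1 {X Y : Type*} [Fintype X] [Nonempty X] [Fintype Y]
    [MeasurableSpace X] [MeasurableSingletonClass X]
    [MeasurableSpace Y] [MeasurableSingletonClass Y]
    (p : X → PMF Y) (h_useful : ∀ y, ∃ x, p x y ≠ 0)
    (hC₁ : maxInputDivergence p ≠ ∞) (hC : 0 < channelCapacity p) :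
    (∀ (M : ℕ), 2 ≤ M → ∀ (c : FeedbackCode X Y M)
        (Ω : Type*) [MeasurableSpace Ω] (μ : Measure Ω) [IsProbabilityMeasure μ]
        (W : Ω → Fin M) (Z : ℕ → Ω → Y), IsTransmission p c μ W Z →
        0 < errorProb c μ W Z ∧
        ∀ δ : ℝ, 0 < δ → δ ≤ 1 / 2 →
          (((1 - δ - errorProb c μ W Z / δ) * (Real.log M / (channelCapacity p).toReal)
              + -Real.log (errorProb c μ W Z) / (maxInputDivergence p).toReal
              - Real.binEntropy δ / (channelCapacity p).toReal
              + (Real.log (minTransitionProb p * δ) - Real.log 4)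
                  / (maxInputDivergence p).toReal : ℝ) : EReal)
            ≤ (expectedTime c μ Z : EReal)) ∧
    ∃ ε : ℝ → ℝ, (∀ t, 0 < ε t) ∧ Tendsto ε (𝓝[>] 0) (𝓝 0) ∧
      ∀ (M : ℕ), 2 ≤ M → ∀ (c : FeedbackCode X Y M)
        (Ω : Type*) [MeasurableSpace Ω] (μ : Measure Ω) [IsProbabilityMeasure μ]
        (W : Ω → Fin M) (Z : ℕ → Ω → Y), IsTransmission p c μ W Z →
          (((Real.log M / (channelCapacity p).toReal
                - Real.log (errorProb c μ W Z) / (maxInputDivergence p).toReal)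
              * (1 - ε (errorProb c μ W Z)) : ℝ) : EReal)
            ≤ (expectedTime c μ Z : EReal) := by
  have hk := channelBounds h_useful hC₁ hC
  refine ⟨fun M hM c Ω _ μ _ W Z h => ⟨h.errorProb_pos hk.pos hM, fun δ hδ hδ' =>
    h.burnashev_le_expectedTime hk hM hδ hδ'⟩, burnashevLoss (channelCapacity p).toReal
      (maxInputDivergence p).toReal (minTransitionProb p),
    burnashevLoss_pos hk.capacity_pos hk.divergence_pos hk.lam_pos hk.lam_le_one,
    tendsto_burnashevLoss _ _ _, fun M hM c Ω _ μ _ W Z h => ?_⟩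
  have hPe := h.errorProb_pos hk.pos hM
  -- The threshold `2` is what makes `δ = 1 / log (1 / P_e)` at most `1 / 2`. Below it the loss is
  -- `1` and the bound reduces to `0 ≤ E[T]`.
  by_cases ht : 2 ≤ -Real.log (errorProb c μ W Z)
  · have hδ' : (-Real.log (errorProb c μ W Z))⁻¹ ≤ 1 / 2 := by
      rw [one_div]
      exact inv_anti₀ (by norm_num) ht
    exact (EReal.coe_le_coe_iff.2 (mul_one_sub_burnashevLoss_le hk.capacity_pos
      hk.divergence_pos hk.lam_pos hk.lam_le_one (Real.log_natCast_nonneg M) hPe ht)).trans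
      (h.burnashev_le_expectedTime hk hM (inv_pos.2 (by linarith)) hδ')
  · rw [burnashevLoss, if_neg fun h => ht h.2, sub_self, mul_zero, EReal.coe_zero]
    exact EReal.coe_ennreal_nonneg _
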